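/- Conventions. A set-sequence equipped with embeddings (ssee) $\mathbf V$ is a sequence $(V_n)_{n\in\mathbb N}$ of finite sets together with, for all $N\le n$, a collection $\binom{V_n}{V_N}$ of injections $V_N\to V_n$, called embeddings. Let $I(N,n)$ be the number of pairs $(\phi_1,\phi_2)$ of elements of $\binom{V_n}{V_N}$ with $1<|\phi_1(V_N)\cap\phi_2(V_N)|<|V_N|$. The ssee is good if $|V_n|\to\infty$ and, for every $N$ with $|V_N|>1$, $$\frac{\left|\binom{V_n}{V_N}\right|}{|V_n|}\to\infty\quad\text{and}\quad \frac{|V_n|\,I(N,n)}{\left|\binom{V_n}{V_N}\right|^2}\to 0\qquad(n\to\infty).$$ A box in $[0,1]^{V}$ is a product $\prod_{v\in V}A_v$ of measurable sets $A_v\subseteq[0,1]$. It is simple if its projection onto each coordinate is a finite union of intervals (which may be open, closed, half-open or degenerate). For $n \geq N$, $\phi\in\binom{V_n}{V_N}$ and $c\subseteq[0,1]^{V_n}$ a box, let $$c_{\downarrow\phi}=\left\{x\in[0,1]^{V_N}:\ \mathrm{vol}_{V_n\setminus\phi(V_N)}\left(\{y\in c:\ y_{\phi(i)}=x_i\ \forall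 i\in V_N\}\right)>0\right\},$$ where $\mathrm{vol}_{V_n\setminus\phi(V_N)}$ is Lebesgue measure in the coordinates outside $\phi(V_N)$ (if there are no such coordinates, a point has measure $1$). For $b\subseteq[0,1]^{V_N}$ and $n\ge N$, let $$\mathrm{Forb}(b)_n=\left\{y\in[0,1]^{V_n}:\ (y_{\phi(i)})_{i\in V_N}\notin b\ \text{ for all } \phi\in\tbinom{V_n}{V_N}\right\}.$$ Write $\mathbb E_\phi$ for the average over $\phi\in\binom{V_n}{V_N}$ chosen uniformly at random (read as $0$ if there are no embeddings, which for large $n$ can happen only when $|V_N|\le 1$). Theorem. Let $\mathbf V$ be a good ssee, let $N\in\mathbb N$, let $\mathcal F$ be a nonempty finite family of simple boxes in $[0,1]^{V_N}$, and set $b=\bigcup_{b_f\in\mathcal F}b_f$ and $\mathcal P=\mathrm{Forb}(b)$. Then for every $\varepsilon>0$ there exists $n_0>0$ with $n_0\ge N$ such that for every $n\ge n_0$ there exists a finite collection $\mathcal C$ of simple boxes in $[0,1]^{V_n}$ satisfying (i) $\mathcal P_n\subseteq\bigcup_{c\in\mathcal C}c$; (ii) for every $c\in\mathcal C$, $\mathbb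 E_\phi\,\mathrm{vol}\left(c_{\downarrow\phi}\cap b\right)<\varepsilon$; (iii) $|\mathcal C|\le e^{\varepsilon|V_n|}$. -/

import Mathlib

open MeasureTheory Filter Topology
open scoped unitInterval BigOperators

universe u

/-- A set-sequence equipped with embeddings (ssee): a sequence of finite sets `V n` with, for all
`N ≤ n`, a collection `emb N n` of injections from `V N` to `V n`. The values of `emb N n` with
`n < N` carry no information: they are never used below. -/
structure SSEE where
  V : ℕ → Type u
  fintypeV : ∀ n, Fintype (V n)
  emb : ∀ N n : ℕ, Finset (V N ↪ V n)

attribute [instance] SSEE.fintypeV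

namespace SSEE

/-- The number of `i`-intersecting embeddings of `(V N₁, V N₂)` into `V n`. A function on the
disjoint union of `V N₁` and `V N₂` is given here by its two restrictions. -/
noncomputable def numIntersecting (S : SSEE.{u}) (i N₁ N₂ n : ℕ) : ℕ :=
  Set.ncard {φ : (S.V N₁ ↪ S.V n) × (S.V N₂ ↪ S.V n) |
    φ.1 ∈ S.emb N₁ n ∧ φ.2 ∈ S.emb N₂ n ∧ (Set.range φ.1 ∩ Set.range φ.2).ncard = i}

/-- The quantity `I(N, n)`: the number of pairs of embeddings of `V N` into `V n` whose images
share more than one and fewer than `|V N|` elements. -/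
noncomputable def overlap (S : SSEE.{u}) (N n : ℕ) : ℕ :=
  ∑ i ∈ Finset.Ioo 1 (Fintype.card (S.V N)), S.numIntersecting i N N n

/-- Good ssee-s. -/
structure IsGood (S : SSEE.{u}) : Prop where
  card_tendsto : Tendsto (fun n => Fintype.card (S.V n)) atTop atTop
  many_embeddings : ∀ N, 1 < Fintype.card (S.V N) →
    Tendsto (fun n => ((S.emb N n).card : ℝ) / (Fintype.card (S.V n) : ℝ)) atTop atTop
  small_overlap : ∀ N, 1 < Fintype.card (S.V N) →
    Tendsto (fun n => ((Fintype.card (S.V n) : ℝ) * (S.overlap N n : ℝ)) /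
      ((S.emb N n).card : ℝ) ^ 2) atTop (𝓝 0)

end SSEE

/-- A finite union of (open, closed, half-open, possibly degenerate) intervals in `[0,1]`. -/
def IsFiniteUnionOfIntervals (A : Set I) : Prop :=
  ∃ T : Set (Set I), T.Finite ∧ (∀ J ∈ T, J.OrdConnected) ∧ A = ⋃₀ T

/-- A box in `[0,1]^V`: a product of measurable subsets of `[0,1]`. -/
def IsBox {V : Type u} (b : Set (V → I)) : Prop :=
  ∃ A : V → Set I, (∀ v, MeasurableSet (A v)) ∧ b = Set.univ.pi A

/-- A simple box: a box whose projection to every coordinate is a finite union of intervals. -/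
def IsSimpleBox {V : Type u} (b : Set (V → I)) : Prop :=
  IsBox b ∧ ∀ v, IsFiniteUnionOfIntervals ((fun c : V → I => c v) '' b)

open Classical in
/-- The strict `φ`-projection of `b ⊆ [0,1]^W` for an injection `φ : V → W`: the points `c` of
`[0,1]^V` such that the section of `b` over `c`, seen in the coordinates outside the range of `φ`,
has positive Lebesgue measure in `[0,1]^(W \ φ(V))`. -/
def projDown {V W : Type u} [Fintype W] (φ : V ↪ W) (b : Set (W → I)) : Set (V → I) :=
  {c | 0 < (volume : Measure ({w : W // w ∉ Set.range φ} → I))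
    {d | ∃ c' ∈ b, (∀ v, c' (φ v) = c v) ∧ ∀ w, c' w.1 = d w}}

/-- The `φ`-lift of `b ⊆ [0,1]^V` for an injection `φ : V → W`. -/
def liftUp {V W : Type u} (φ : V ↪ W) (b : Set (V → I)) : Set (W → I) :=
  {c | ∃ c' ∈ b, ∀ v, c' v = c (φ v)}

namespace SSEE

/-- The upper shadow of `b ⊆ [0,1]^(V N)` in `[0,1]^(V n)`. -/
def upperShadow (S : SSEE.{u}) {N : ℕ} (b : Set (S.V N → I)) (n : ℕ) : Set (S.V n → I) :=
  ⋃ φ ∈ S.emb N n, liftUp φ b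

/-- The property of being `b`-free, for `b ⊆ [0,1]^(V N)` and `n ≥ N`. -/
def Forb (S : SSEE.{u}) {N : ℕ} (b : Set (S.V N → I)) (n : ℕ) : Set (S.V n → I) :=
  (S.upperShadow b n)ᶜ

end SSEE

/-!
Colour `[0,1]` by finitely many intervals, so finely that the colours of the coordinates of a point
of `[0,1]^(V N)` decide whether it lies in `b`. The pairs of an embedding `φ` and a colour pattern
occurring in `b` are the edges of a uniform hypergraph on `V n × colours`, the colours of a `b`-free
point form an independent set, and the points whose coloured coordinates all lie in a given vertex
set form a simple box. It thus suffices to cover the independent sets by few vertex sets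
(containers) spanning few edges. Goodness makes the number of pairs of edges with more than one
common vertex small compared with `#E ^ 2 / |X|`.

Let `J` be independent, in an `r`-uniform hypergraph. An edge of `C ⊇ J` with `j` of its vertices
marked, all of them in `J`, cannot exist for `j = r`, and for `j = 0` it is just an edge of `C`.
To pass from few edges with `j + 1` marks to few edges with `j` marks, delete from `C` the
vertices that lie in many edges with `j` marks. These degrees are read off from a sparse random
subset `T` of `J`: the number of edges through a vertex with marks in `T` concentrates, since two
of them are correlated only if they share a second vertex. The set `S` of the vertices of `J` that
this would delete is small, because the degrees of the vertices of `J` add up to `j + 1` times the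
number of edges with `j + 1` marks. So each step depends only on two small sets `T` and `S`, and
there are `exp(o(|X|))` containers.
-/

open scoped Finset

universe v

section BinomialMean

variable {X κ : Type*} {q : ℝ}

/-- The mean of a function of the random subset of `J` in which every element is kept independently
with probability `q`. -/
noncomputable def binomialMean (q : ℝ) (J : Finset X) : (Finset X → ℝ) →ₗ[ℝ] ℝ :=
  ∑ T ∈ J.powerset, (q ^ #T * (1 - q) ^ (#J - #T)) • LinearMap.proj T

lemma binomialMean_apply (q : ℝ) (J : Finset X) (Φ : Finset X → ℝ) :
    binomialMean q J Φ = ∑ T ∈ J.powerset, q ^ #T * (1 - q) ^ (#J - #T) * Φ T := by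
  simp [binomialMean]

lemma binomialMean_one (q : ℝ) (J : Finset X) : binomialMean q J 1 = 1 := by
  simp [binomialMean_apply, Finset.sum_pow_mul_eq_add_pow]

lemma exists_subset_le_of_binomialMean_le (hq₀ : 0 < q) (hq₁ : q < 1) {J : Finset X}
    {Φ : Finset X → ℝ} {a : ℝ} (hΦ : binomialMean q J Φ ≤ a) : ∃ T ⊆ J, Φ T ≤ a := by
  have hmean : binomialMean q J Φ ≤ binomialMean q J (a • 1) := by
    rwa [map_smul, binomialMean_one, smul_eq_mul, mul_one]
  rw [binomialMean_apply, binomialMean_apply] at hmean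
  obtain ⟨T, hT, hle⟩ := Finset.exists_le_of_sum_le (Finset.powerset_nonempty J) hmean
  have hweight : 0 < q ^ #T * (1 - q) ^ (#J - #T) :=
    mul_pos (pow_pos hq₀ _) (pow_pos (sub_pos.2 hq₁) _)
  exact ⟨T, Finset.mem_powerset.1 hT, by simpa using le_of_mul_le_mul_left hle hweight⟩

lemma exists_subset_le_two_mul_of_binomialMean_le (hq₀ : 0 < q) (hq₁ : q < 1) {J : Finset X}
    {Φ Ψ : Finset X → ℝ} (hΦ : 0 ≤ Φ) (hΨ : 0 ≤ Ψ) {a b : ℝ} (ha : 0 < a) (hb : 0 < b)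
    (hΦa : binomialMean q J Φ ≤ a) (hΨb : binomialMean q J Ψ ≤ b) :
    ∃ T ⊆ J, Φ T ≤ 2 * a ∧ Ψ T ≤ 2 * b := by
  have hmean : binomialMean q J (a⁻¹ • Φ + b⁻¹ • Ψ) ≤ 2 := by
    rw [map_add, map_smul, map_smul, smul_eq_mul, smul_eq_mul, inv_mul_eq_div, inv_mul_eq_div]
    linarith [div_le_one_of_le₀ hΦa ha.le, div_le_one_of_le₀ hΨb hb.le]
  obtain ⟨T, hTJ, hT⟩ := exists_subset_le_of_binomialMean_le hq₀ hq₁ hmean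
  simp only [Pi.add_apply, Pi.smul_apply, smul_eq_mul, inv_mul_eq_div] at hT
  refine ⟨T, hTJ, ?_, ?_⟩
  · rw [← div_le_iff₀ ha]
    linarith [div_nonneg (hΨ T) hb.le]
  · rw [← div_le_iff₀ hb]
    linarith [div_nonneg (hΦ T) ha.le]

variable [DecidableEq X]

lemma binomialMean_superset (q : ℝ) {A J : Finset X} (hA : A ⊆ J) :
    binomialMean q J (fun T => if A ⊆ T then 1 else 0) = q ^ #A := by
  have hsupersets : {T ∈ J.powerset | A ⊆ T} = (J \ A).powerset.image (A ∪ ·) := by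
    rw [← Finset.Icc_eq_image_powerset hA]
    ext T
    simp [and_comm]
  have hdisj : ∀ T ∈ (J \ A).powerset, Disjoint A T := fun T hT =>
    Finset.disjoint_sdiff.mono_right (Finset.mem_powerset.1 hT)
  simp only [binomialMean_apply, mul_ite, mul_one, mul_zero]
  rw [← Finset.sum_filter, hsupersets, Finset.sum_image]
  · have htotal := binomialMean_one q (J \ A)
    simp only [binomialMean_apply, Pi.one_apply, mul_one] at htotal
    refine Eq.trans ?_ ((congrArg (q ^ #A * ·) htotal).trans (mul_one _))
    rw [Finset.mul_sum]
    refine Finset.sum_congr rfl fun T hT => ?_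
    rw [Finset.card_union_of_disjoint (hdisj T hT), Finset.card_sdiff_of_subset hA, pow_add,
      Nat.sub_add_eq, mul_assoc]
  · intro T hT T' hT' hunion
    rw [← Finset.union_sdiff_cancel_left (hdisj T hT),
      ← Finset.union_sdiff_cancel_left (hdisj T' hT')]
    exact congrArg (· \ A) hunion

lemma binomialMean_card_filter_subset (q : ℝ) {J : Finset X} (Q : Finset κ) (A : κ → Finset X)
    (hA : ∀ p ∈ Q, A p ⊆ J) :
    binomialMean q J (fun T => (#{p ∈ Q | A p ⊆ T} : ℝ)) = ∑ p ∈ Q, q ^ #(A p) := by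
  have hcount : (fun T => (#{p ∈ Q | A p ⊆ T} : ℝ)) =
      ∑ p ∈ Q, fun T => if A p ⊆ T then (1 : ℝ) else 0 := by
    ext T
    simp
  rw [hcount, map_sum]
  exact Finset.sum_congr rfl fun p hp => binomialMean_superset q (hA p hp)

lemma binomialMean_card {X : Type*} (q : ℝ) (J : Finset X) :
    binomialMean q J (fun T => (#T : ℝ)) = q * #J := by
  classical
  calc binomialMean q J (fun T => (#T : ℝ))
      = binomialMean q J (fun T => (#{x ∈ J | {x} ⊆ T} : ℝ)) := by
        rw [binomialMean_apply, binomialMean_apply]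
        refine Finset.sum_congr rfl fun T hT => ?_
        simp only [Finset.singleton_subset_iff]
        rw [Finset.filter_mem_eq_inter, Finset.inter_eq_right.2 (Finset.mem_powerset.1 hT)]
    _ = q * #J := by
        rw [binomialMean_card_filter_subset q J _ fun x hx => Finset.singleton_subset_iff.2 hx]
        simp [mul_comm]

/-- Disjoint members are kept independently of each other, so only intersecting pairs contribute to
the variance. -/
lemma binomialMean_sq_card_filter_subset_sub_le (hq₀ : 0 ≤ q) (hq₁ : q ≤ 1) {J : Finset X} {j : ℕ}
    (Q : Finset κ) (A : κ → Finset X) (hA : ∀ p ∈ Q, A p ⊆ J) (hj : ∀ p ∈ Q, #(A p) = j) :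
    binomialMean q J (fun T => ((#{p ∈ Q | A p ⊆ T} : ℝ) - q ^ j * #Q) ^ 2) ≤
      #{p ∈ Q ×ˢ Q | ¬ Disjoint (A p.1) (A p.2)} := by
  set N : Finset X → ℝ := fun T => (#{p ∈ Q | A p ⊆ T} : ℝ)
  set μ : ℝ := q ^ j * #Q
  have hfirst : binomialMean q J N = μ := by
    rw [binomialMean_card_filter_subset q Q A hA, Finset.sum_congr rfl fun p hp => by rw [hj p hp]]
    simp [μ, mul_comm]
  have hsecond : binomialMean q J (N ^ 2) = ∑ p ∈ Q ×ˢ Q, q ^ #(A p.1 ∪ A p.2) := by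
    rw [← binomialMean_card_filter_subset q (J := J) (Q ×ˢ Q) fun p => A p.1 ∪ A p.2]
    · congr 1
      ext T
      simp_rw [Finset.union_subset_iff]
      rw [Finset.filter_product (s := Q) (t := Q) (fun p => A p ⊆ T) (fun p => A p ⊆ T)]
      simp [N, sq]
    · intro p hp
      rw [Finset.mem_product] at hp
      exact Finset.union_subset (hA _ hp.1) (hA _ hp.2)
  have hvariance : binomialMean q J (fun T => (N T - μ) ^ 2) =
      ∑ p ∈ Q ×ˢ Q, (q ^ #(A p.1 ∪ A p.2) - q ^ (2 * j)) := by
    have hexpand : (fun T => (N T - μ) ^ 2) = N ^ 2 - (2 * μ) • N + μ ^ 2 • 1 := by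
      ext T
      simp only [Pi.add_apply, Pi.sub_apply, Pi.pow_apply, Pi.smul_apply, Pi.one_apply, smul_eq_mul]
      ring
    rw [hexpand, map_add, map_sub, map_smul, map_smul, hfirst, hsecond, binomialMean_one,
      Finset.sum_sub_distrib, Finset.sum_const, Finset.card_product]
    simp only [μ, smul_eq_mul, nsmul_eq_mul, Nat.cast_mul]
    ring
  rw [hvariance, Finset.natCast_card_filter]
  refine Finset.sum_le_sum fun p hp => ?_
  rw [Finset.mem_product] at hp
  split_ifs with hdisj
  · rw [Finset.card_union_of_disjoint hdisj, hj _ hp.1, hj _ hp.2, two_mul, sub_self]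
  · linarith [pow_le_one₀ hq₀ hq₁ (n := #(A p.1 ∪ A p.2)), pow_nonneg hq₀ (2 * j)]

end BinomialMean

/-- This replaces Chebyshev's inequality: `t ≤ D` is far from `p * d` unless `d` is at most of order
`D / p`. -/
lemma le_two_mul_div_add_sq_sub_div {p D d t : ℝ} (hp : 0 < p) (hD : 0 < D) (ht : t ≤ D) :
    d ≤ 2 * D / p + 2 * (t - p * d) ^ 2 / (p * D) := by
  have hmul : D * (p * d) ≤ 2 * D ^ 2 + 2 * (t - p * d) ^ 2 := by
    rcases le_total (p * d) D with hle | hge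
    · nlinarith [mul_le_mul_of_nonneg_left hle hD.le, sq_nonneg (t - p * d), sq_nonneg D]
    · nlinarith [sq_nonneg (4 * (p * d) - 5 * D), mul_nonneg (sub_nonneg.2 ht) (sub_nonneg.2 hge),
        sq_nonneg (D - t)]
  calc d = D * (p * d) / (p * D) := by field_simp
    _ ≤ (2 * D ^ 2 + 2 * (t - p * d) ^ 2) / (p * D) := by gcongr
    _ = 2 * D / p + 2 * (t - p * d) ^ 2 / (p * D) := by field_simp

section Hypergraph

variable {X : Type u} {ι : Type v} [DecidableEq X] (E : Finset ι) (h : ι → Finset X)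

/-- The pairs of edges with at least two common elements. A hypergraph is given by an indexed family
`h e`, `e ∈ E`, of finite sets, so that edges may be repeated. -/
def overlapPairs : Finset (ι × ι) :=
  {p ∈ E ×ˢ E | 1 < #(h p.1 ∩ h p.2)}

/-- The pairs of an edge inside `C` and a set of `j` marked elements of it, all of them in `J`. -/
def markedEdges (C J : Finset X) (j : ℕ) : Finset (Σ _ : ι, Finset X) :=
  {e ∈ E | h e ⊆ C}.sigma fun e => (h e ∩ J).powersetCard j

/-- The marked edges in which `v` is an unmarked element. -/
def markedLink (C J : Finset X) (j : ℕ) (v : X) : Finset (Σ _ : ι, Finset X) :=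
  {p ∈ markedEdges E h C J j | v ∈ h p.1 \ p.2}

/-- The container obtained from `C` by deleting all elements outside `S` that are unmarked in more
than `D` of the edges marked by `j` elements of `T`. -/
noncomputable def pruned (D : ℝ) (C T S : Finset X) (j : ℕ) : Finset X :=
  {v ∈ C | (#(markedLink E h C T j v) : ℝ) ≤ D ∨ v ∈ S}

variable {E h} {C J T : Finset X} {j r : ℕ}

lemma mem_markedEdges {p : Σ _ : ι, Finset X} :
    p ∈ markedEdges E h C J j ↔ (p.1 ∈ E ∧ h p.1 ⊆ C) ∧ (p.2 ⊆ h p.1 ∧ p.2 ⊆ J) ∧ #p.2 = j := by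
  rw [markedEdges, Finset.mem_sigma, Finset.mem_filter, Finset.mem_powersetCard,
    Finset.subset_inter_iff]

lemma mem_markedLink {p : Σ _ : ι, Finset X} {v : X} :
    p ∈ markedLink E h C J j v ↔ p ∈ markedEdges E h C J j ∧ v ∈ h p.1 ∧ v ∉ p.2 := by
  rw [markedLink, Finset.mem_filter, Finset.mem_sdiff]

lemma markedEdges_subset_left {C' : Finset X} (hC : C' ⊆ C) :
    markedEdges E h C' J j ⊆ markedEdges E h C J j := fun p hp => by
  rw [mem_markedEdges] at hp ⊢
  exact ⟨⟨hp.1.1, hp.1.2.trans hC⟩, hp.2⟩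

lemma filter_markedLink_subset (hTJ : T ⊆ J) (v : X) :
    {p ∈ markedLink E h C J j v | p.2 ⊆ T} = markedLink E h C T j v := by
  ext p
  simp only [Finset.mem_filter, mem_markedLink, mem_markedEdges]
  have : p.2 ⊆ T → p.2 ⊆ J := fun hp => hp.trans hTJ
  tauto

lemma card_markedLink_le_of_subset (hTJ : T ⊆ J) (v : X) :
    #(markedLink E h C T j v) ≤ #(markedLink E h C J j v) := by
  rw [← filter_markedLink_subset hTJ]
  exact Finset.card_filter_le _ _

lemma markedEdges_eq_empty_of_independent (hr : ∀ e ∈ E, #(h e) = r) (hJ : ∀ e ∈ E, ¬ h e ⊆ J) :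
    markedEdges E h C J r = ∅ := by
  refine Finset.eq_empty_of_forall_notMem fun p hp => ?_
  obtain ⟨⟨hpE, -⟩, ⟨hph, hpJ⟩, hcard⟩ := mem_markedEdges.1 hp
  rw [Finset.eq_of_subset_of_card_le hph (by rw [hr _ hpE, hcard])] at hpJ
  exact hJ _ hpE hpJ

lemma card_markedEdges_zero : #(markedEdges E h C J 0) = #{e ∈ E | h e ⊆ C} := by
  simp [markedEdges]

/-- Marking one more element `v` turns the marked edges through `v` into edges with `j + 1` marked
elements, each of which arises from all of its marked elements. -/
lemma sum_card_markedLink (C J : Finset X) (j : ℕ) :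
    ∑ v ∈ J, #(markedLink E h C J j v) = (j + 1) * #(markedEdges E h C J (j + 1)) := by
  have hmark : ∀ v ∈ J,
      #(markedLink E h C J j v) = #{p ∈ markedEdges E h C J (j + 1) | v ∈ p.2} := by
    intro v hv
    refine Finset.card_nbij' (fun p => ⟨p.1, insert v p.2⟩) (fun p => ⟨p.1, p.2.erase v⟩)
      ?_ ?_ ?_ ?_
    · intro p hp
      simp only [Finset.mem_coe, mem_markedLink, Finset.mem_filter, mem_markedEdges,
        Finset.insert_subset_iff, Finset.mem_insert_self, and_true] at hp ⊢
      obtain ⟨⟨hpE, ⟨hph, hpJ⟩, hcard⟩, hvh, hvp⟩ := hp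
      exact ⟨hpE, ⟨⟨hvh, hph⟩, hv, hpJ⟩, by rw [Finset.card_insert_of_notMem hvp, hcard]⟩
    · intro p hp
      simp only [Finset.mem_coe, mem_markedLink, Finset.mem_filter, mem_markedEdges] at hp ⊢
      obtain ⟨⟨hpE, ⟨hph, hpJ⟩, hcard⟩, hvp⟩ := hp
      have herase := Finset.erase_subset v p.2
      exact ⟨⟨hpE, ⟨herase.trans hph, herase.trans hpJ⟩,
        by rw [Finset.card_erase_of_mem hvp, hcard, Nat.add_sub_cancel]⟩,
        hph hvp, Finset.notMem_erase v _⟩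
    · intro p hp
      simp [Finset.erase_insert (mem_markedLink.1 hp).2.2]
    · intro p hp
      simp [Finset.insert_erase (Finset.mem_filter.1 hp).2]
  rw [Finset.sum_congr rfl hmark, mul_comm]
  refine (Finset.sum_card_bipartiteAbove_eq_sum_card_bipartiteBelow
    fun v (p : Σ _ : ι, Finset X) => v ∈ p.2).trans (Finset.sum_const_nat fun p hp => ?_)
  obtain ⟨-, ⟨-, hpJ⟩, hcard⟩ := mem_markedEdges.1 hp
  rw [Finset.bipartiteBelow, Finset.filter_mem_eq_inter, Finset.inter_eq_right.2 hpJ, hcard]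

lemma card_markedEdges_le_sum_card_markedLink (hr : ∀ e ∈ E, #(h e) = r) (hj : j < r)
    {C' : Finset X} (hC : C' ⊆ C) :
    #(markedEdges E h C' J j) ≤ ∑ v ∈ C', #(markedLink E h C J j v) := by
  have hunmarked : ∀ p ∈ markedEdges E h C' J j, 1 ≤ #{v ∈ C' | v ∈ h p.1 \ p.2} := by
    intro p hp
    obtain ⟨⟨hpE, hpC⟩, -, hcard⟩ := mem_markedEdges.1 hp
    obtain ⟨v, hvh, hvp⟩ := Finset.exists_mem_notMem_of_card_lt_card (s := p.2) (t := h p.1)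
      (by rwa [hcard, hr _ hpE])
    exact Finset.card_pos.2
      ⟨v, Finset.mem_filter.2 ⟨hpC hvh, Finset.mem_sdiff.2 ⟨hvh, hvp⟩⟩⟩
  calc #(markedEdges E h C' J j)
      ≤ ∑ p ∈ markedEdges E h C' J j, #{v ∈ C' | v ∈ h p.1 \ p.2} := by
        simpa using Finset.sum_le_sum hunmarked
    _ ≤ ∑ p ∈ markedEdges E h C J j, #{v ∈ C' | v ∈ h p.1 \ p.2} :=
        Finset.sum_le_sum_of_subset (markedEdges_subset_left hC)
    _ = ∑ v ∈ C', #(markedLink E h C J j v) :=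
        (Finset.sum_card_bipartiteAbove_eq_sum_card_bipartiteBelow
          fun v (p : Σ _ : ι, Finset X) => v ∈ h p.1 \ p.2).symm

/-- Two marked edges that share an unmarked and a marked element belong to an overlapping pair of
edges, and such a pair has at most `r * 2 ^ r * 2 ^ r` choices of shared element and markings. -/
lemma sum_card_intersecting_markedLink_le (hr : ∀ e ∈ E, #(h e) = r) (C J : Finset X) (j : ℕ) :
    ∑ v ∈ C, #{p ∈ markedLink E h C J j v ×ˢ markedLink E h C J j v | ¬ Disjoint p.1.2 p.2.2} ≤
      r * 4 ^ r * #(overlapPairs E h) := by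
  have hchoices : ∀ e ∈ overlapPairs E h,
      #(h e.1 ×ˢ (h e.1).powerset ×ˢ (h e.2).powerset) = r * 4 ^ r := by
    intro e he
    obtain ⟨⟨he₁, he₂⟩, -⟩ := by simpa [overlapPairs] using he
    rw [Finset.card_product, Finset.card_product, Finset.card_powerset, Finset.card_powerset,
      hr _ he₁, hr _ he₂, ← mul_pow]
    norm_num
  rw [← Finset.card_sigma, mul_comm, ← Finset.sum_const_nat hchoices, ← Finset.card_sigma]
  refine Finset.card_le_card_of_injOn
    (fun x => ⟨(x.2.1.1, x.2.2.1), (x.1, x.2.1.2, x.2.2.2)⟩) ?_ ?_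
  · rintro ⟨v, ⟨e, A⟩, ⟨e', A'⟩⟩ hx
    simp only [Finset.mem_coe, Finset.mem_sigma, Finset.mem_filter, Finset.mem_product,
      mem_markedLink, mem_markedEdges, overlapPairs, Finset.mem_powerset] at hx ⊢
    obtain ⟨-, ⟨⟨⟨⟨he, -⟩, ⟨hA, -⟩, -⟩, hv, hvA⟩, ⟨⟨he', -⟩, ⟨hA', -⟩, -⟩, hv', -⟩, hmeet⟩ := hx
    obtain ⟨x, hxA, hxA'⟩ := Finset.not_disjoint_iff.1 hmeet
    refine ⟨⟨⟨he, he'⟩, Finset.one_lt_card.2 ⟨x, ?_, v, ?_, ?_⟩⟩, hv, hA, hA'⟩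
    · exact Finset.mem_inter.2 ⟨hA hxA, hA' hxA'⟩
    · exact Finset.mem_inter.2 ⟨hv, hv'⟩
    · exact ne_of_mem_of_not_mem hxA hvA
  · rintro ⟨v, ⟨e, A⟩, ⟨e', A'⟩⟩ - ⟨w, ⟨f, B⟩, ⟨f', B'⟩⟩ - heq
    simp only [Sigma.mk.injEq, Prod.mk.injEq, heq_eq_eq] at heq
    obtain ⟨⟨rfl, rfl⟩, rfl, rfl, rfl⟩ := heq
    rfl

lemma pruned_subset (D : ℝ) (C T S : Finset X) (j : ℕ) : pruned E h D C T S j ⊆ C :=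
  Finset.filter_subset _ _

/-- Each unmarked element of the pruned container outside `S` has a small degree in the sample `T`,
so its degree in `J` is small up to its deviation from the scaled degree in `T`. -/
lemma card_markedEdges_pruned_le (hr : ∀ e ∈ E, #(h e) = r) (hj : j < r) {p D : ℝ} (hp : 0 < p)
    (hD : 0 < D) (C J T S : Finset X) :
    (#(markedEdges E h (pruned E h D C T S j) J j) : ℝ) ≤
      ∑ v ∈ S, #(markedLink E h C J j v) + (2 * D / p * #C +
        2 * (∑ v ∈ C, (#(markedLink E h C T j v) - p * #(markedLink E h C J j v) : ℝ) ^ 2) /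
          (p * D)) := by
  set C' := pruned E h D C T S j
  set bound : X → ℝ := fun v =>
    2 * D / p + 2 * (#(markedLink E h C T j v) - p * #(markedLink E h C J j v) : ℝ) ^ 2 / (p * D)
  have hbound : ∀ v, 0 ≤ bound v := fun v => by positivity
  have hdegree : ∀ v ∈ C', (#(markedLink E h C J j v) : ℝ) ≤
      (if v ∈ S then (#(markedLink E h C J j v) : ℝ) else 0) + bound v := by
    intro v hv
    split_ifs with hvS
    · exact le_add_of_nonneg_right (hbound v)
    · rw [zero_add]
      exact le_two_mul_div_add_sq_sub_div hp hD
        ((Finset.mem_filter.1 hv).2.resolve_right hvS)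
  calc (#(markedEdges E h C' J j) : ℝ)
      ≤ ∑ v ∈ C', (#(markedLink E h C J j v) : ℝ) :=
        mod_cast card_markedEdges_le_sum_card_markedLink hr hj (pruned_subset D C T S j)
    _ ≤ ∑ v ∈ C', (if v ∈ S then (#(markedLink E h C J j v) : ℝ) else 0) + ∑ v ∈ C', bound v :=
        (Finset.sum_le_sum hdegree).trans_eq Finset.sum_add_distrib
    _ ≤ ∑ v ∈ S, (#(markedLink E h C J j v) : ℝ) + ∑ v ∈ C, bound v := by
        gcongr
        · rw [← Finset.sum_filter, Finset.filter_mem_eq_inter]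
          exact Finset.sum_le_sum_of_subset_of_nonneg Finset.inter_subset_right
            fun _ _ _ => Nat.cast_nonneg _
        · exact pruned_subset D C T S j
    _ = _ := by
        simp only [bound, Finset.sum_add_distrib, Finset.sum_const, ← Finset.sum_div,
          ← Finset.mul_sum, nsmul_eq_mul, Nat.cast_sum]
        ring

lemma mul_card_filter_lt_card_markedLink_le {D : ℝ} (hTJ : T ⊆ J) (C : Finset X) (j : ℕ) :
    D * #{v ∈ J | D < #(markedLink E h C T j v)} ≤ (j + 1) * #(markedEdges E h C J (j + 1)) := by
  calc D * #{v ∈ J | D < #(markedLink E h C T j v)}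
      = ∑ v ∈ J with D < #(markedLink E h C T j v), D := by
        rw [Finset.sum_const, nsmul_eq_mul, mul_comm]
    _ ≤ ∑ v ∈ J with D < #(markedLink E h C T j v), (#(markedLink E h C J j v) : ℝ) :=
        Finset.sum_le_sum fun v hv => (Finset.mem_filter.1 hv).2.le.trans
          (mod_cast card_markedLink_le_of_subset hTJ v)
    _ ≤ ∑ v ∈ J, (#(markedLink E h C J j v) : ℝ) :=
        Finset.sum_le_sum_of_subset_of_nonneg (Finset.filter_subset _ _)
          fun _ _ _ => Nat.cast_nonneg _
    _ = (j + 1) * #(markedEdges E h C J (j + 1)) := mod_cast sum_card_markedLink C J j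

variable [Fintype X] [Nonempty X]

lemma exists_sparse_sample (hr : ∀ e ∈ E, #(h e) = r) {q V : ℝ} (hq₀ : 0 < q) (hq₁ : q < 1)
    (hV : 0 < V) (hoverlap : (r * 4 ^ r * #(overlapPairs E h) : ℝ) ≤ V) (C J : Finset X) (j : ℕ) :
    ∃ T ⊆ J, (#T : ℝ) ≤ 2 * (q * Fintype.card X) ∧
      ∑ v ∈ C, (#(markedLink E h C T j v) - q ^ j * #(markedLink E h C J j v) : ℝ) ^ 2 ≤ 2 * V := by
  set deviation : X → Finset X → ℝ := fun v T =>
    (#{p ∈ markedLink E h C J j v | p.2 ⊆ T} - q ^ j * #(markedLink E h C J j v) : ℝ) ^ 2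
  have hsize : binomialMean q J (fun T => (#T : ℝ)) ≤ q * Fintype.card X := by
    rw [binomialMean_card]
    gcongr
    exact Finset.card_le_univ J
  have hvariance : binomialMean q J (∑ v ∈ C, deviation v) ≤ V := by
    rw [map_sum]
    refine (Finset.sum_le_sum fun v _ => binomialMean_sq_card_filter_subset_sub_le hq₀.le hq₁.le
      (markedLink E h C J j v) (fun p => p.2) ?_ ?_).trans ?_
    · exact fun p hp => (mem_markedEdges.1 (mem_markedLink.1 hp).1).2.1.2
    · exact fun p hp => (mem_markedEdges.1 (mem_markedLink.1 hp).1).2.2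
    · exact le_trans (mod_cast sum_card_intersecting_markedLink_le hr C J j) hoverlap
  obtain ⟨T, hTJ, hTcard, hTsum⟩ := exists_subset_le_two_mul_of_binomialMean_le hq₀ hq₁
    (fun T => Nat.cast_nonneg _)
    (Finset.sum_nonneg fun v _ T => sq_nonneg _)
    (mul_pos hq₀ (Nat.cast_pos.2 Fintype.card_pos)) hV hsize hvariance
  refine ⟨T, hTJ, hTcard, ?_⟩
  simpa only [deviation, Finset.sum_apply, filter_markedLink_subset hTJ] using hTsum

lemma exists_fingerprints (hr : ∀ e ∈ E, #(h e) = r) (hj : j < r) {q D V : ℝ} (hq₀ : 0 < q)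
    (hq₁ : q < 1) (hD : 0 < D) (hV : 0 < V)
    (hoverlap : (r * 4 ^ r * #(overlapPairs E h) : ℝ) ≤ V) (hJC : J ⊆ C) :
    ∃ T S : Finset X, (#T : ℝ) ≤ 2 * (q * Fintype.card X) ∧
      D * #S ≤ (j + 1) * #(markedEdges E h C J (j + 1)) ∧ J ⊆ pruned E h D C T S j ∧
      (#(markedEdges E h (pruned E h D C T S j) J j) : ℝ) ≤
        (j + 1) * #(markedEdges E h C J (j + 1)) +
          (2 * D / q ^ j * Fintype.card X + 4 * V / (q ^ j * D)) := by
  obtain ⟨T, hTJ, hTcard, hdeviation⟩ := exists_sparse_sample hr hq₀ hq₁ hV hoverlap C J j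
  refine ⟨T, {v ∈ J | D < #(markedLink E h C T j v)}, hTcard,
    mul_card_filter_lt_card_markedLink_le hTJ C j, fun v hv => ?_, ?_⟩
  · rw [pruned, Finset.mem_filter, Finset.mem_filter]
    exact ⟨hJC hv, (le_or_gt _ D).imp_right fun hlt => ⟨hv, hlt⟩⟩
  · refine (card_markedEdges_pruned_le hr hj (pow_pos hq₀ j) hD C J T _).trans ?_
    gcongr ?_ + (_ * ?_ + ?_ / _)
    · norm_cast
      rw [← sum_card_markedLink]
      exact Finset.sum_le_sum_of_subset (Finset.filter_subset _ _)
    · exact mod_cast Finset.card_le_univ C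
    · linarith

end Hypergraph

/-- With the threshold `D = θ * #E / |X|`, a suitable `θ` makes the edges that survive only because
their degrees are below `D` negligible, and `γ` then makes the deviation of the sample
negligible. -/
lemma exists_pruned {j r : ℕ} (hj : j < r) {q η : ℝ} (hq₀ : 0 < q) (hq₁ : q < 1) (hη : 0 < η) :
    ∃ θ : ℝ, ∃ η' > 0, ∃ γ > 0, ∀ {X : Type u} {ι : Type v} [DecidableEq X] [Fintype X]
      {E : Finset ι} {h : ι → Finset X}, E.Nonempty → (∀ e ∈ E, #(h e) = r) →
      (#(overlapPairs E h) * Fintype.card X : ℝ) ≤ γ * #E ^ 2 →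
      ∀ {C J : Finset X}, J ⊆ C → (#(markedEdges E h C J (j + 1)) : ℝ) ≤ η' * #E →
      ∃ T S : Finset X, (#T : ℝ) ≤ 2 * q * Fintype.card X ∧ (#S : ℝ) ≤ 2 * q * Fintype.card X ∧
        J ⊆ pruned E h (θ * #E / Fintype.card X) C T S j ∧
        (#(markedEdges E h (pruned E h (θ * #E / Fintype.card X) C T S j) J j) : ℝ) ≤ η * #E := by
  have hr : (0 : ℝ) < r := by exact_mod_cast Nat.zero_lt_of_lt hj
  set θ : ℝ := η * q ^ j / 16 with hθ
  have hθ₀ : 0 < θ := by positivity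
  refine ⟨θ, min (η / 4) (2 * q * θ) / (j + 1), by positivity, 2 * θ ^ 2 / (r * 4 ^ r),
    by positivity, fun {X ι} _ _ {E h} hE hunif hoverlap {C J} hJC hsparse => ?_⟩
  obtain ⟨e, he⟩ := hE
  obtain ⟨x, -⟩ := Finset.card_pos.1 ((Nat.zero_lt_of_lt hj).trans_eq (hunif e he).symm)
  have : Nonempty X := ⟨x⟩
  have hX : (0 : ℝ) < Fintype.card X := by exact_mod_cast Fintype.card_pos
  have hE : (0 : ℝ) < #E := by exact_mod_cast Finset.card_pos.2 ⟨e, he⟩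
  set D : ℝ := θ * #E / Fintype.card X with hD
  have hD₀ : 0 < D := by positivity
  have hV : r * 4 ^ r * #(overlapPairs E h) ≤ 2 * θ * #E * D := by
    calc r * 4 ^ r * (#(overlapPairs E h) : ℝ)
        = r * 4 ^ r / Fintype.card X * (#(overlapPairs E h) * Fintype.card X) := by field_simp
      _ ≤ r * 4 ^ r / Fintype.card X * (2 * θ ^ 2 / (r * 4 ^ r) * #E ^ 2) := by gcongr
      _ = 2 * θ * #E * D := by rw [hD]; field_simp
  have hmarked : (j + 1) * (#(markedEdges E h C J (j + 1)) : ℝ) ≤ min (η / 4) (2 * q * θ) * #E := by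
    calc (j + 1) * (#(markedEdges E h C J (j + 1)) : ℝ)
        ≤ (j + 1) * (min (η / 4) (2 * q * θ) / (j + 1) * #E) := by gcongr
      _ = min (η / 4) (2 * q * θ) * #E := by field_simp
  obtain ⟨T, S, hT, hS, hJ, hpruned⟩ :=
    exists_fingerprints hunif hj hq₀ hq₁ hD₀ (by positivity) hV hJC
  refine ⟨T, S, by rwa [mul_assoc], ?_, hJ, hpruned.trans ?_⟩
  · refine le_of_mul_le_mul_left ?_ hD₀
    calc D * #S ≤ min (η / 4) (2 * q * θ) * #E := hS.trans hmarked
      _ ≤ 2 * q * θ * #E := by gcongr; exact min_le_right _ _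
      _ = D * (2 * q * Fintype.card X) := by rw [hD]; field_simp
  · have hlow : 2 * D / q ^ j * Fintype.card X + 4 * (2 * θ * #E * D) / (q ^ j * D) =
        5 / 8 * η * #E := by
      rw [hD, hθ]
      field_simp
      ring
    linarith [hmarked.trans (mul_le_mul_of_nonneg_right (min_le_left _ _) hE.le),
      mul_pos hη hE]

lemma exists_containers_of_level {r : ℕ} {q : ℝ} (hq₀ : 0 < q) (hq₁ : q < 1) (k : ℕ) :
    ∀ j, j + k = r → ∀ η > 0, ∃ γ > 0, ∀ {X : Type u} {ι : Type v} [DecidableEq X] [Fintype X]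
      {E : Finset ι} {h : ι → Finset X}, E.Nonempty → (∀ e ∈ E, #(h e) = r) →
      (#(overlapPairs E h) * Fintype.card X : ℝ) ≤ γ * #E ^ 2 →
      ∃ 𝒞 : Finset (Finset X),
        #𝒞 ≤ #{S : Finset X | (#S : ℝ) ≤ 2 * q * Fintype.card X} ^ (2 * k) ∧
        ∀ J : Finset X, (∀ e ∈ E, ¬ h e ⊆ J) →
          ∃ C ∈ 𝒞, J ⊆ C ∧ (#(markedEdges E h C J j) : ℝ) ≤ η * #E := by
  induction k with
  | zero =>
    rintro j rfl η hη
    refine ⟨1, one_pos, fun {X ι} _ _ {E h} _ hunif _ => ⟨{Finset.univ}, by simp, fun J hJ =>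
      ⟨_, Finset.mem_singleton_self _, J.subset_univ, ?_⟩⟩⟩
    rw [add_zero] at hunif
    rw [markedEdges_eq_empty_of_independent hunif hJ, Finset.card_empty, Nat.cast_zero]
    positivity
  | succ k ih =>
    rintro j hj η hη
    obtain ⟨θ, η', hη', γ₁, hγ₁, hprune⟩ := exists_pruned (j := j) (r := r) (by omega) hq₀ hq₁ hη
    obtain ⟨γ₂, hγ₂, hcontainers⟩ := ih (j + 1) (by omega) η' hη'
    refine ⟨min γ₁ γ₂, lt_min hγ₁ hγ₂, fun {X ι} _ _ {E h} hE hunif hoverlap => ?_⟩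
    obtain ⟨𝒞, h𝒞card, h𝒞⟩ := hcontainers hE hunif
      (hoverlap.trans (mul_le_mul_of_nonneg_right (min_le_right _ _) (sq_nonneg _)))
    set 𝒮 : Finset (Finset X) := {S : Finset X | (#S : ℝ) ≤ 2 * q * Fintype.card X}
    refine ⟨(𝒞 ×ˢ 𝒮 ×ˢ 𝒮).image
      fun c => pruned E h (θ * #E / Fintype.card X) c.1 c.2.1 c.2.2 j, ?_, fun J hJ => ?_⟩
    · calc _ ≤ #𝒞 * (#𝒮 * #𝒮) := by
            simpa only [Finset.card_product] using Finset.card_image_le (s := 𝒞 ×ˢ 𝒮 ×ˢ 𝒮)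
        _ ≤ #𝒮 ^ (2 * k) * (#𝒮 * #𝒮) := by gcongr
        _ = #𝒮 ^ (2 * (k + 1)) := by ring
    · obtain ⟨C, hC, hJC, hsparse⟩ := h𝒞 J hJ
      obtain ⟨T, S, hT, hS, hJpruned, hpruned⟩ := hprune hE hunif
        (hoverlap.trans (mul_le_mul_of_nonneg_right (min_le_left _ _) (sq_nonneg _))) hJC hsparse
      refine ⟨_, Finset.mem_image.2 ⟨(C, T, S), ?_, rfl⟩, hJpruned, hpruned⟩
      simpa only [Finset.mem_product, 𝒮, Finset.mem_filter_univ] using ⟨hC, hT, hS⟩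

lemma card_filter_card_le_le_exp {L t : ℝ} (hL : 0 ≤ L) (X : Type*) [Fintype X] :
    (#{S : Finset X | (#S : ℝ) ≤ t} : ℝ) ≤ Real.exp (L * t + Real.exp (-L) * Fintype.card X) := by
  set z := Real.exp (-L)
  rw [Real.exp_add, ← inv_mul_le_iff₀ (Real.exp_pos _), ← Real.exp_neg]
  calc Real.exp (-(L * t)) * #{S : Finset X | (#S : ℝ) ≤ t}
      = ∑ S : Finset X with #S ≤ t, Real.exp (-(L * t)) := by
        rw [Finset.sum_const, nsmul_eq_mul, mul_comm]
    _ ≤ ∑ S : Finset X with #S ≤ t, z ^ #S := by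
        refine Finset.sum_le_sum fun S hS => ?_
        rw [← Real.exp_nat_mul, Real.exp_le_exp]
        linarith [mul_le_mul_of_nonneg_left (Finset.mem_filter.1 hS).2 hL]
    _ ≤ ∑ S : Finset X, z ^ #S :=
        Finset.sum_le_sum_of_subset_of_nonneg (Finset.filter_subset _ _) fun _ _ _ => by positivity
    _ = (z + 1) ^ Fintype.card X := by
        simpa using Fintype.sum_pow_mul_eq_add_pow X z 1
    _ ≤ Real.exp (z * Fintype.card X) := by
        rw [mul_comm, Real.exp_nat_mul]
        gcongr
        exact Real.add_one_le_exp z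

lemma card_filter_card_le_sq_mul_le_exp {ε : ℝ} (hε : 0 < ε) (X : Type*) [Fintype X] :
    (#{S : Finset X | (#S : ℝ) ≤ ε ^ 2 / 4 * Fintype.card X} : ℝ) ≤
      Real.exp (ε * Fintype.card X) := by
  have hexp : Real.exp (-(2 / ε)) ≤ ε / 2 := by
    rw [Real.exp_neg, inv_le_comm₀ (Real.exp_pos _) (by positivity), inv_div]
    linarith [Real.add_one_le_exp (2 / ε)]
  refine (card_filter_card_le_le_exp (L := 2 / ε) (by positivity) X).trans (Real.exp_le_exp.2 ?_)
  calc 2 / ε * (ε ^ 2 / 4 * Fintype.card X) + Real.exp (-(2 / ε)) * Fintype.card X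
      ≤ 2 / ε * (ε ^ 2 / 4 * Fintype.card X) + ε / 2 * Fintype.card X := by gcongr
    _ = ε * Fintype.card X := by field_simp; ring

theorem exists_containers (r : ℕ) {ε η : ℝ} (hε : 0 < ε) (hη : 0 < η) :
    ∃ γ > 0, ∀ {X : Type u} {ι : Type v} [DecidableEq X] [Fintype X]
      {E : Finset ι} {h : ι → Finset X}, (∀ e ∈ E, #(h e) = r) →
      (#(overlapPairs E h) * Fintype.card X : ℝ) ≤ γ * #E ^ 2 →
      ∃ 𝒞 : Finset (Finset X), (#𝒞 : ℝ) ≤ Real.exp (ε * Fintype.card X) ∧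
        (∀ C ∈ 𝒞, (#{e ∈ E | h e ⊆ C} : ℝ) ≤ η * #E) ∧
        ∀ J : Finset X, (∀ e ∈ E, ¬ h e ⊆ J) → ∃ C ∈ 𝒞, J ⊆ C := by
  set ε' := min ε 1 / (2 * r + 1) with hε'
  have hε'₀ : 0 < ε' := by positivity
  have hε'₁ : ε' ≤ 1 := div_le_one_of_le₀
    ((min_le_right ε 1).trans (le_add_of_nonneg_left (by positivity))) (by positivity)
  have hcount : 2 * r * ε' ≤ ε := by
    calc 2 * r * ε' ≤ (2 * r + 1) * ε' := by linarith
      _ = min ε 1 := by rw [hε']; field_simp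
      _ ≤ ε := min_le_left _ _
  obtain ⟨γ, hγ, hcontainers⟩ := exists_containers_of_level.{u, v} (q := ε' ^ 2 / 8)
    (by positivity) (by nlinarith) r 0 (zero_add r) η hη
  refine ⟨γ, hγ, fun {X ι} _ _ {E h} hunif hoverlap => ?_⟩
  obtain rfl | hE := E.eq_empty_or_nonempty
  · refine ⟨{Finset.univ}, ?_, by simp, by simp⟩
    rw [Finset.card_singleton, Nat.cast_one, Real.one_le_exp_iff]
    positivity
  obtain ⟨𝒞, h𝒞card, h𝒞⟩ := hcontainers hE hunif hoverlap
  refine ⟨{C ∈ 𝒞 | (#{e ∈ E | h e ⊆ C} : ℝ) ≤ η * #E}, ?_,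
    fun C hC => (Finset.mem_filter.1 hC).2, fun J hJ => ?_⟩
  · calc (#{C ∈ 𝒞 | (#{e ∈ E | h e ⊆ C} : ℝ) ≤ η * #E} : ℝ)
        ≤ (#{S : Finset X | (#S : ℝ) ≤ 2 * (ε' ^ 2 / 8) * Fintype.card X} : ℝ) ^ (2 * r) :=
          mod_cast (Finset.card_filter_le _ _).trans h𝒞card
      _ ≤ Real.exp (ε' * Fintype.card X) ^ (2 * r) := by
          rw [show 2 * (ε' ^ 2 / 8) = ε' ^ 2 / 4 by ring]
          gcongr
          exact card_filter_card_le_sq_mul_le_exp hε'₀ X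
      _ = Real.exp (2 * r * ε' * Fintype.card X) := by
          rw [← Real.exp_nat_mul, Nat.cast_mul, Nat.cast_ofNat, mul_assoc (2 * r : ℝ)]
      _ ≤ Real.exp (ε * Fintype.card X) := by gcongr
  · obtain ⟨C, hC, hJC, hsparse⟩ := h𝒞 J hJ
    rw [card_markedEdges_zero] at hsparse
    exact ⟨C, Finset.mem_filter.2 ⟨hC, hsparse⟩, hJC⟩

lemma exists_ordConnected_colouring {α : Type*} [Preorder α] {𝒯 : Set (Set α)} (hfin : 𝒯.Finite)
    (h𝒯 : ∀ J ∈ 𝒯, J.OrdConnected) :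
    ∃ (k : ℕ) (κ : α → Fin k), (∀ a, (κ ⁻¹' {a}).OrdConnected) ∧
      ∀ J ∈ 𝒯, ∀ x y, κ x = κ y → x ∈ J → y ∈ J := by
  have := hfin.to_subtype
  let side : α → 𝒯 → Prop × Prop := fun x J =>
    (x ∈ upperClosure (J : Set α), x ∈ lowerClosure (J : Set α))
  refine ⟨Nat.card (𝒯 → Prop × Prop), Finite.equivFin _ ∘ side, fun a => ⟨?_⟩, ?_⟩
  · rintro x rfl z hz y ⟨hxy, hyz⟩
    refine congrArg (Finite.equivFin (𝒯 → Prop × Prop)) (funext fun J => ?_)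
    obtain ⟨hupper, hlower⟩ : (z ∈ upperClosure (J : Set α) ↔ x ∈ upperClosure (J : Set α)) ∧
        (z ∈ lowerClosure (J : Set α) ↔ x ∈ lowerClosure (J : Set α)) := by
      simpa [side] using congrFun ((Finite.equivFin _).injective hz) J
    simp only [side, Prod.mk.injEq, eq_iff_iff]
    exact ⟨⟨fun hy => hupper.1 ((upperClosure _).upper hyz hy), (upperClosure _).upper hxy⟩,
      ⟨(lowerClosure _).lower hxy, fun hx => (lowerClosure _).lower hyz (hlower.2 hx)⟩⟩
  · intro J hJ x y hxy hx
    obtain ⟨hupper, hlower⟩ : (x ∈ upperClosure J ↔ y ∈ upperClosure J) ∧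
        (x ∈ lowerClosure J ↔ y ∈ lowerClosure J) := by
      simpa [side] using congrFun ((Finite.equivFin _).injective hxy) ⟨J, hJ⟩
    rw [← (h𝒯 J hJ).upperClosure_inter_lowerClosure] at hx ⊢
    exact ⟨hupper.1 hx.1, hlower.1 hx.2⟩

lemma IsBox.mem_of_forall_mem_image {V : Type u} {b : Set (V → I)} (hb : IsBox b) {x : V → I}
    (hx : ∀ v, x v ∈ (fun c : V → I => c v) '' b) : x ∈ b := by
  obtain ⟨A, -, rfl⟩ := hb
  intro v hv
  obtain ⟨c, hc, hcx⟩ := hx v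
  exact hcx ▸ hc v hv

lemma exists_colouring_of_isSimpleBox {V : Type u} [Finite V] (F : Finset (Set (V → I)))
    (hF : ∀ f ∈ F, IsSimpleBox f) :
    ∃ (k : ℕ) (κ : I → Fin k), (∀ a, (κ ⁻¹' {a}).OrdConnected) ∧
      ∀ x y : V → I, κ ∘ x = κ ∘ y → x ∈ ⋃ f ∈ F, f → y ∈ ⋃ f ∈ F, f := by
  have hintervals : ∀ (f : F) (v : V), ∃ T : Set (Set I), T.Finite ∧
      (∀ J ∈ T, J.OrdConnected) ∧ (fun c : V → I => c v) '' f.1 = ⋃₀ T :=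
    fun f v => (hF f.1 f.2).2 v
  choose T hfin hconn hproj using hintervals
  obtain ⟨k, κ, hκ, hsat⟩ := exists_ordConnected_colouring (𝒯 := ⋃ f, ⋃ v, T f v)
    (Set.finite_iUnion fun f => Set.finite_iUnion fun v => hfin f v)
    (by simpa only [Set.mem_iUnion, forall_exists_index] using fun J f v => hconn f v J)
  refine ⟨k, κ, hκ, fun x y hxy hx => ?_⟩
  obtain ⟨f, hf, hxf⟩ := Set.mem_iUnion₂.1 hx
  refine Set.mem_iUnion₂.2 ⟨f, hf, (hF f hf).1.mem_of_forall_mem_image fun v => ?_⟩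
  obtain ⟨J, hJ, hxJ⟩ := hproj ⟨f, hf⟩ v ▸ Set.mem_image_of_mem _ hxf
  exact hproj ⟨f, hf⟩ v ▸
    ⟨J, hJ, hsat J (Set.mem_iUnion₂.2 ⟨_, v, hJ⟩) _ _ (congrFun hxy v) hxJ⟩

section Templates

variable {V W : Type u} {K : Type v}

/-- The box of the points whose colours are allowed by the template `C`, a set of pairs of a
coordinate and a colour. -/
def templateBox (κ : I → K) (C : Finset (W × K)) : Set (W → I) :=
  Set.univ.pi fun w => {x | (w, κ x) ∈ C}

lemma isSimpleBox_templateBox [Finite K] {κ : I → K} (hκ : ∀ a, (κ ⁻¹' {a}).OrdConnected)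
    (C : Finset (W × K)) : IsSimpleBox (templateBox κ C) := by
  have hunion : ∀ w, {x | (w, κ x) ∈ C} = ⋃₀ ((fun a => κ ⁻¹' {a}) '' {a | (w, a) ∈ C}) := by
    intro w
    ext x
    simp
  refine ⟨⟨_, fun w => ?_, rfl⟩, fun w => ?_⟩
  · rw [hunion]
    refine MeasurableSet.sUnion ((Set.toFinite _).image _).countable ?_
    rintro _ ⟨a, -, rfl⟩
    exact (hκ a).measurableSet
  · obtain hempty | hne := (templateBox κ C).eq_empty_or_nonempty
    · exact ⟨∅, Set.finite_empty, by simp, by simp [hempty]⟩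
    · refine ⟨_, (Set.toFinite {a | (w, a) ∈ C}).image fun a => κ ⁻¹' {a}, ?_,
        (Set.eval_image_univ_pi hne).trans (hunion w)⟩
      rintro _ ⟨a, -, rfl⟩
      exact hκ a

lemma mem_of_mem_projDown [Fintype W] {φ : V ↪ W} {c : Set (W → I)} {x : V → I}
    (hx : x ∈ projDown φ c) : ∃ y ∈ c, ∀ v, y (φ v) = x v := by
  rw [projDown, Set.mem_ofPred_eq] at hx
  obtain ⟨-, y, hy, hyx, -⟩ := nonempty_of_measure_ne_zero hx.ne'
  exact ⟨y, hy, hyx⟩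

variable [Fintype V]

/-- The colour patterns of the points of `b`. -/
noncomputable def colourPatterns [Finite K] (κ : I → K) (b : Set (V → I)) : Finset (V → K) :=
  (Set.toFinite ((κ ∘ ·) '' b)).toFinset

lemma mem_colourPatterns [Finite K] {κ : I → K} {b : Set (V → I)} {f : V → K} :
    f ∈ colourPatterns κ b ↔ ∃ x ∈ b, κ ∘ x = f := by
  simp [colourPatterns]

/-- The edge of the pattern hypergraph given by an embedding and a colour pattern. -/
def patternEdge (p : (V ↪ W) × (V → K)) : Finset (W × K) :=
  Finset.univ.map ⟨fun i => (p.1 i, p.2 i), fun _ _ h => p.1.injective (Prod.ext_iff.1 h).1⟩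

lemma card_patternEdge (p : (V ↪ W) × (V → K)) : #(patternEdge p) = Fintype.card V := by
  simp [patternEdge]

lemma patternEdge_subset_iff {p : (V ↪ W) × (V → K)} {C : Finset (W × K)} :
    patternEdge p ⊆ C ↔ ∀ i, (p.1 i, p.2 i) ∈ C := by
  simp only [patternEdge, Finset.subset_iff, Finset.mem_map, Finset.mem_univ, true_and,
    forall_exists_index, forall_apply_eq_imp_iff]
  rfl

variable [DecidableEq W] [DecidableEq K]

lemma card_patternEdge_inter_le (p p' : (V ↪ W) × (V → K)) :
    #(patternEdge p ∩ patternEdge p') ≤ #(Finset.univ.map p.1 ∩ Finset.univ.map p'.1) := by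
  refine Finset.card_le_card_of_injOn Prod.fst ?_ ?_
  · intro x hx
    simp only [patternEdge, Finset.mem_coe, Finset.mem_inter, Finset.mem_map, Finset.mem_univ,
      true_and] at hx ⊢
    obtain ⟨⟨i, rfl⟩, i', hi'⟩ := hx
    exact ⟨⟨i, rfl⟩, i', congrArg Prod.fst hi'⟩
  · intro x hx y hy hxy
    simp only [patternEdge, Finset.mem_coe, Finset.mem_inter, Finset.mem_map, Finset.mem_univ,
      true_and] at hx hy
    obtain ⟨⟨i, rfl⟩, -⟩ := hx
    obtain ⟨⟨i', rfl⟩, -⟩ := hy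
    rw [p.1.injective hxy]

lemma card_overlapPairs_patternEdge_le (A : Finset (V ↪ W)) (B : Finset (V → K)) :
    #(overlapPairs (A ×ˢ B) patternEdge) ≤
      #(overlapPairs A (Finset.univ.map ·)) * #B ^ 2 := by
  rw [sq, ← Finset.card_product, ← Finset.card_product]
  refine Finset.card_le_card_of_injOn (fun p => ((p.1.1, p.2.1), (p.1.2, p.2.2))) ?_ ?_
  · intro p hp
    simp only [overlapPairs, Finset.mem_coe, Finset.mem_filter, Finset.mem_product] at hp ⊢
    obtain ⟨⟨⟨hφ, hf⟩, hφ', hf'⟩, hinter⟩ := hp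
    exact ⟨⟨⟨hφ, hφ'⟩, hinter.trans_le (card_patternEdge_inter_le _ _)⟩, hf, hf'⟩
  · rintro ⟨⟨φ, f⟩, φ', f'⟩ - ⟨⟨ψ, g⟩, ψ', g'⟩ - heq
    simp only [Prod.mk.injEq] at heq ⊢
    tauto

lemma card_overlapPairs_patternEdge_mul_card_le [Fintype W] [Fintype K] {A : Finset (V ↪ W)}
    {γ : ℝ} (hA : (#(overlapPairs A (Finset.univ.map ·)) * Fintype.card W : ℝ) ≤ γ * #A ^ 2)
    (B : Finset (V → K)) :
    (#(overlapPairs (A ×ˢ B) patternEdge) * Fintype.card (W × K) : ℝ) ≤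
      γ * Fintype.card K * #(A ×ˢ B) ^ 2 := by
  have hpairs : (#(overlapPairs (A ×ˢ B) patternEdge) : ℝ) ≤
      #(overlapPairs A (Finset.univ.map ·)) * #B ^ 2 :=
    mod_cast card_overlapPairs_patternEdge_le A B
  rw [Fintype.card_prod, Finset.card_product, Nat.cast_mul, Nat.cast_mul]
  calc _ ≤ #(overlapPairs A (Finset.univ.map ·)) * #B ^ 2 *
        (Fintype.card W * Fintype.card K : ℝ) := by gcongr
    _ = #(overlapPairs A (Finset.univ.map ·)) * Fintype.card W *
        (Fintype.card K * #B ^ 2 : ℝ) := by ring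
    _ ≤ γ * #A ^ 2 * (Fintype.card K * #B ^ 2) := by gcongr
    _ = γ * Fintype.card K * (#A * #B) ^ 2 := by ring

variable [Fintype W] {κ : I → K}

/-- The graph of the colour pattern of `y`, the smallest template whose box contains `y`. -/
def colourGraph (κ : I → K) (y : W → I) : Finset (W × K) :=
  Finset.univ.image fun w => (w, κ (y w))

lemma mem_templateBox_iff_colourGraph_subset {C : Finset (W × K)} {y : W → I} :
    y ∈ templateBox κ C ↔ colourGraph κ y ⊆ C := by
  simp [templateBox, colourGraph, Finset.subset_iff]

variable [Finite K] {b : Set (V → I)}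

lemma volume_real_projDown_templateBox_le (C : Finset (W × K)) (φ : V ↪ W) :
    volume.real (projDown φ (templateBox κ C) ∩ b) ≤
      #{f ∈ colourPatterns κ b | patternEdge (φ, f) ⊆ C} := by
  obtain hempty | ⟨x, hx, hxb⟩ := (projDown φ (templateBox κ C) ∩ b).eq_empty_or_nonempty
  · rw [hempty, measureReal_empty]
    positivity
  · obtain ⟨y, hy, hyx⟩ := mem_of_mem_projDown hx
    have hpattern : κ ∘ x ∈ {f ∈ colourPatterns κ b | patternEdge (φ, f) ⊆ C} :=
      Finset.mem_filter.2 ⟨mem_colourPatterns.2 ⟨x, hxb, rfl⟩,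
        patternEdge_subset_iff.2 fun i => by simpa [hyx] using hy (φ i) trivial⟩
    exact measureReal_le_one.trans (mod_cast Finset.card_pos.2 ⟨_, hpattern⟩)

lemma expect_volume_real_projDown_templateBox_le {A : Finset (V ↪ W)} {C : Finset (W × K)} {η : ℝ}
    (hη : 0 ≤ η) (hC : (#{e ∈ A ×ˢ colourPatterns κ b | patternEdge e ⊆ C} : ℝ) ≤
      η * #(A ×ˢ colourPatterns κ b)) :
    𝔼 φ ∈ A, volume.real (projDown φ (templateBox κ C) ∩ b) ≤ η * #(colourPatterns κ b) := by
  rw [Finset.expect_eq_sum_div_card]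
  refine div_le_of_le_mul₀ (by positivity) (by positivity) ?_
  calc ∑ φ ∈ A, volume.real (projDown φ (templateBox κ C) ∩ b)
      ≤ ∑ φ ∈ A, (#{f ∈ colourPatterns κ b | patternEdge (φ, f) ⊆ C} : ℝ) :=
        Finset.sum_le_sum fun φ _ => volume_real_projDown_templateBox_le C φ
    _ = #{e ∈ A ×ˢ colourPatterns κ b | patternEdge e ⊆ C} := by
        simp only [Finset.card_filter, Finset.sum_product, Nat.cast_sum]
    _ ≤ η * #(A ×ˢ colourPatterns κ b) := hC
    _ = η * #(colourPatterns κ b) * #A := by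
        rw [Finset.card_product, Nat.cast_mul]
        ring

lemma not_patternEdge_subset_colourGraph {A : Finset (V ↪ W)}
    (hb : ∀ x y : V → I, κ ∘ x = κ ∘ y → x ∈ b → y ∈ b) {y : W → I}
    (hy : y ∉ ⋃ φ ∈ A, liftUp φ b) :
    ∀ e ∈ A ×ˢ colourPatterns κ b, ¬ patternEdge e ⊆ colourGraph κ y := by
  rintro ⟨φ, f⟩ he hsub
  obtain ⟨hφ, hf⟩ := Finset.mem_product.1 he
  obtain ⟨x, hxb, rfl⟩ := mem_colourPatterns.1 hf
  refine hy (Set.mem_biUnion (Finset.mem_coe.2 hφ) ⟨y ∘ φ, hb x _ (funext fun i => ?_) hxb,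
    fun _ => rfl⟩)
  simpa [colourGraph, eq_comm] using patternEdge_subset_iff.1 hsub i

end Templates

theorem mainTheorem4_general {V : Type u} [Fintype V] (F : Finset (Set (V → I)))
    (hF : ∀ f ∈ F, IsSimpleBox f) {ε : ℝ} (hε : 0 < ε) :
    ∃ γ > 0, ∀ {W : Type u} [Fintype W] [DecidableEq W] (A : Finset (V ↪ W)),
      (#(overlapPairs A (Finset.univ.map ·)) * Fintype.card W : ℝ) ≤ γ * #A ^ 2 →
      ∃ C : Finset (Set (W → I)), (∀ c ∈ C, IsSimpleBox c) ∧
        (⋃ φ ∈ A, liftUp φ (⋃ f ∈ F, f))ᶜ ⊆ ⋃ c ∈ C, c ∧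
        (∀ c ∈ C, 𝔼 φ ∈ A, volume.real (projDown φ c ∩ ⋃ f ∈ F, f) < ε) ∧
        (#C : ℝ) ≤ Real.exp (ε * Fintype.card W) := by
  classical
  obtain ⟨k, κ, hκ, hsat⟩ := exists_colouring_of_isSimpleBox F hF
  set b := ⋃ f ∈ F, f
  set B := colourPatterns κ b
  obtain ⟨γ, hγ, hcontainers⟩ := exists_containers.{u, u} (Fintype.card V)
    (ε := ε / (k + 1)) (η := ε / (#B + 1)) (by positivity) (by positivity)
  refine ⟨γ / (k + 1), by positivity, fun {W} _ _ A hA => ?_⟩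
  have hoverlap : (#(overlapPairs (A ×ˢ B) patternEdge) * Fintype.card (W × Fin k) : ℝ) ≤
      γ * #(A ×ˢ B) ^ 2 := by
    refine (card_overlapPairs_patternEdge_mul_card_le hA B).trans ?_
    gcongr
    rw [Fintype.card_fin, div_mul_eq_mul_div, div_le_iff₀ (by positivity)]
    linarith
  obtain ⟨𝒞, hcard, hsparse, hcover⟩ := hcontainers (fun e _ => card_patternEdge e) hoverlap
  refine ⟨𝒞.image (templateBox κ), ?_, fun y hy => ?_, ?_, ?_⟩
  · exact Finset.forall_mem_image.2 fun C _ => isSimpleBox_templateBox hκ C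
  · obtain ⟨C, hC, hyC⟩ := hcover _ (not_patternEdge_subset_colourGraph hsat hy)
    exact Set.mem_biUnion (Finset.mem_coe.2 (Finset.mem_image_of_mem _ hC))
      (mem_templateBox_iff_colourGraph_subset.2 hyC)
  · refine Finset.forall_mem_image.2 fun C hC =>
      (expect_volume_real_projDown_templateBox_le (by positivity) (hsparse C hC)).trans_lt ?_
    rw [div_mul_eq_mul_div, div_lt_iff₀ (by positivity)]
    linarith
  · calc (#(𝒞.image (templateBox κ)) : ℝ) ≤ #𝒞 := mod_cast Finset.card_image_le
      _ ≤ Real.exp (ε / (k + 1) * Fintype.card (W × Fin k)) := hcard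
      _ ≤ Real.exp (ε * Fintype.card W) := by
        rw [Real.exp_le_exp, Fintype.card_prod, Fintype.card_fin, Nat.cast_mul,
          div_mul_eq_mul_div, div_le_iff₀ (by positivity)]
        nlinarith [mul_nonneg hε.le (Nat.cast_nonneg (α := ℝ) (Fintype.card W))]

section Embeddings

variable {V W : Type u} [Fintype V] [DecidableEq W]

lemma card_filter_map_univ_subset_le (A : Finset (V ↪ W)) (φ : V ↪ W) :
    #{ψ ∈ A | Finset.univ.map ψ ⊆ Finset.univ.map φ} ≤ Fintype.card V ^ Fintype.card V := by
  classical
  calc #{ψ ∈ A | Finset.univ.map ψ ⊆ Finset.univ.map φ}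
      ≤ #(Fintype.piFinset fun _ : V => Finset.univ.map φ) := by
        refine Finset.card_le_card_of_injOn (fun ψ => ψ) (fun ψ hψ => ?_)
          DFunLike.coe_injective.injOn
        refine Finset.mem_coe.2 (Fintype.mem_piFinset.2 fun v => ?_)
        exact (Finset.mem_filter.1 hψ).2 (Finset.mem_map_of_mem ψ (Finset.mem_univ v))
    _ = Fintype.card V ^ Fintype.card V := by simp

lemma card_overlapPairs_map_univ_le (A : Finset (V ↪ W)) :
    #(overlapPairs A (Finset.univ.map ·)) ≤
      #{p ∈ A ×ˢ A | #(Finset.univ.map p.1 ∩ Finset.univ.map p.2) ∈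
        Finset.Ioo 1 (Fintype.card V)} + Fintype.card V ^ Fintype.card V * #A := by
  have hsplit : overlapPairs A (Finset.univ.map ·) ⊆
      {p ∈ A ×ˢ A | #(Finset.univ.map p.1 ∩ Finset.univ.map p.2) ∈ Finset.Ioo 1 (Fintype.card V)} ∪
        {p ∈ A ×ˢ A | Finset.univ.map p.2 ⊆ Finset.univ.map p.1} := by
    intro p hp
    obtain ⟨hpA, hp⟩ := Finset.mem_filter.1 hp
    rw [Finset.mem_union, Finset.mem_filter, Finset.mem_filter, Finset.mem_Ioo]
    refine (lt_or_ge #(Finset.univ.map p.1 ∩ Finset.univ.map p.2) (Fintype.card V)).imp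
      (fun hlt => ⟨hpA, hp, hlt⟩) fun hge => ⟨hpA, ?_⟩
    exact Finset.inter_eq_right.1 (Finset.eq_of_subset_of_card_le Finset.inter_subset_right
      (by simpa using hge))
  refine (Finset.card_le_card hsplit).trans ((Finset.card_union_le _ _).trans ?_)
  gcongr
  calc #{p ∈ A ×ˢ A | Finset.univ.map p.2 ⊆ Finset.univ.map p.1}
      = ∑ φ ∈ A, #{ψ ∈ A | Finset.univ.map ψ ⊆ Finset.univ.map φ} := by
        simp only [Finset.card_filter, Finset.sum_product]
    _ ≤ ∑ _φ ∈ A, Fintype.card V ^ Fintype.card V :=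
        Finset.sum_le_sum fun φ _ => card_filter_map_univ_subset_le A φ
    _ = Fintype.card V ^ Fintype.card V * #A := by rw [Finset.sum_const, smul_eq_mul, mul_comm]

end Embeddings

namespace SSEE

open scoped Classical in
lemma overlap_eq_card (S : SSEE.{u}) (N n : ℕ) :
    S.overlap N n = #{p ∈ S.emb N n ×ˢ S.emb N n |
      #(Finset.univ.map p.1 ∩ Finset.univ.map p.2) ∈ Finset.Ioo 1 (Fintype.card (S.V N))} := by
  rw [overlap, Finset.card_eq_sum_card_fiberwise
    (f := fun p : (S.V N ↪ S.V n) × (S.V N ↪ S.V n) =>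
      #(Finset.univ.map p.1 ∩ Finset.univ.map p.2))
    (t := Finset.Ioo 1 (Fintype.card (S.V N)))
    fun p hp => Finset.mem_coe.2 (Finset.mem_filter.1 (Finset.mem_coe.1 hp)).2]
  refine Finset.sum_congr rfl fun i hi => ?_
  rw [numIntersecting, ← Set.ncard_coe_finset]
  congr 1
  ext p
  have hinter : (Set.range p.1 ∩ Set.range p.2).ncard =
      #(Finset.univ.map p.1 ∩ Finset.univ.map p.2) := by
    rw [← Set.ncard_coe_finset]
    simp
  simp only [Set.mem_ofPred_eq, hinter, Finset.coe_filter, Finset.mem_filter, Finset.mem_product]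
  constructor
  · rintro ⟨h₁, h₂, rfl⟩
    exact ⟨⟨⟨h₁, h₂⟩, hi⟩, rfl⟩
  · rintro ⟨⟨⟨h₁, h₂⟩, -⟩, hp⟩
    exact ⟨h₁, h₂, hp⟩

open scoped Classical in
lemma IsGood.tendsto_card_overlapPairs {S : SSEE.{u}} (hS : S.IsGood) (N : ℕ) :
    Tendsto (fun n => (#(overlapPairs (S.emb N n) (Finset.univ.map ·)) *
      Fintype.card (S.V n) : ℝ) / #(S.emb N n) ^ 2) atTop (𝓝 0) := by
  set r := Fintype.card (S.V N)
  obtain hr | hr := le_or_gt r 1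
  · have hempty : ∀ n, overlapPairs (S.emb N n) (Finset.univ.map ·) = ∅ := fun n =>
      Finset.filter_false_of_mem fun p _ => not_lt.2
        ((Finset.card_le_card Finset.inter_subset_left).trans (by simpa using hr))
    simp [hempty]
  · have hbound : Tendsto (fun n => Fintype.card (S.V n) * S.overlap N n / (#(S.emb N n) : ℝ) ^ 2 +
        r ^ r / (#(S.emb N n) / Fintype.card (S.V n) : ℝ)) atTop (𝓝 0) := by
      simpa using (hS.small_overlap N hr).add
        ((hS.many_embeddings N hr).const_div_atTop (r ^ r : ℝ))
    refine squeeze_zero (fun n => by positivity) (fun n => ?_) hbound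
    have hpairs : (#(overlapPairs (S.emb N n) (Finset.univ.map ·)) : ℝ) ≤
        S.overlap N n + r ^ r * #(S.emb N n) := by
      rw [S.overlap_eq_card]
      exact_mod_cast card_overlapPairs_map_univ_le (S.emb N n)
    calc _ ≤ (S.overlap N n + r ^ r * #(S.emb N n)) * Fintype.card (S.V n) /
          (#(S.emb N n) : ℝ) ^ 2 := by gcongr
      _ = _ := by field_simp

open scoped Classical in
lemma IsGood.eventually_card_overlapPairs_le {S : SSEE.{u}} (hS : S.IsGood) (N : ℕ) {γ : ℝ}
    (hγ : 0 < γ) :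
    ∀ᶠ n in atTop, (#(overlapPairs (S.emb N n) (Finset.univ.map ·)) * Fintype.card (S.V n) : ℝ) ≤
      γ * #(S.emb N n) ^ 2 := by
  filter_upwards [(hS.tendsto_card_overlapPairs N).eventually_le_const hγ] with n hn
  obtain hempty | hne := (S.emb N n).eq_empty_or_nonempty
  · simp [hempty, overlapPairs]
  · exact (div_le_iff₀ (pow_pos (Nat.cast_pos.2 hne.card_pos) 2)).1 hn

end SSEE

theorem mainTheorem4 (S : SSEE.{u}) (hS : S.IsGood) (N : ℕ)
    (F : Finset (Set (S.V N → I))) (hF : F.Nonempty) (hFbox : ∀ f ∈ F, IsSimpleBox f)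
    (b : Set (S.V N → I)) (hb : b = ⋃ f ∈ F, f) (ε : ℝ) (hε : 0 < ε) :
    ∃ n₀ : ℕ, 0 < n₀ ∧ N ≤ n₀ ∧ ∀ n ≥ n₀,
      ∃ C : Finset (Set (S.V n → I)),
        (∀ c ∈ C, IsSimpleBox c) ∧
        S.Forb b n ⊆ ⋃ c ∈ C, c ∧
        (∀ c ∈ C,
          (𝔼 φ ∈ S.emb N n, (volume : Measure (S.V N → I)).real (projDown φ c ∩ b)) < ε) ∧
        (C.card : ℝ) ≤ Real.exp (ε * (Fintype.card (S.V n) : ℝ)) := by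
  classical
  subst hb
  obtain ⟨γ, hγ, hcontainers⟩ := mainTheorem4_general F hFbox hε
  obtain ⟨n₀, hn₀⟩ := eventually_atTop.1 (hS.eventually_card_overlapPairs_le N hγ)
  exact ⟨max n₀ (N + 1), by positivity, by omega,
    fun n hn => hcontainers (S.emb N n) (hn₀ n (by omega))⟩
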